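/- **Proposition 4.3.** Let $p$ be a prime number. Products of maps are read from left to right, so $(fg)(i)=g(f(i))$, and automorphisms are written on the right of their arguments. Let $\lambda_\infty$ and $\mu_\infty$ be the bijections of $\mathbb{Z}$ defined by $$\lambda_\infty(i)=i+1,\qquad \mu_\infty(i)=\begin{cases} i+1, & i\not\equiv p-1 \pmod p,\\ i-(p-1), & i\equiv p-1 \pmod p.\end{cases}$$ For each $i\in\mathbb{Z}$ let $C_i$ be a cyclic group of order $p$ with a generator $c_i$. Let $H_\infty$ be the direct product (with finite supports, i.e. the direct sum) of the groups $C_i$ ($i\in\mathbb{Z}$), and let $\alpha_\infty$ and $\beta_\infty$ be the automorphisms of $H_\infty$ given by $$c_i\alpha_\infty=c_{\mu_\infty(i)},\qquad c_i\beta_\infty=c_{(\lambda_\infty^{-1}\mu_\infty\lambda_\infty)(i)}\qquad(i\in\mathbb{Z}).$$ Let $A_\infty$ and $B_\infty$ be the split extensions (semidirect products) of $H_\infty$ by the cyclic groups $\langle\alpha_\infty\rangle,\langle\beta_\infty\rangle\le\operatorname{Aut}H_\infty$, respectively. Then the following statements hold. 1. The generalized free product $P_\infty$ of the groups $A_\infty$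 and $B_\infty$ with the amalgamated subgroup $H_\infty$ is residually $p$-finite: for every $x\in P_\infty\setminus\{1\}$ there is a homomorphism $\sigma$ of $P_\infty$ onto a finite $p$-group such that $x\sigma\neq 1$. 2. The automorphism $\alpha_\infty^{-1}\beta_\infty$ has infinite order. -/

import Mathlib

namespace AmalgP

/-- A group `G` is residually `p`-finite: every `x ≠ 1` has a non-trivial image under some
homomorphism of `G` onto a finite `p`-group. (The codomain may be taken in the universe of `G`,
since it is isomorphic to a quotient of `G`.) -/
def IsResiduallyPFinite.{u} (p : ℕ) (G : Type u) [Group G] : Prop :=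
  ∀ x : G, x ≠ 1 → ∃ (Q : Type u) (_ : Group Q) (σ : G →* Q),
    Finite Q ∧ IsPGroup p Q ∧ Function.Surjective σ ∧ σ x ≠ 1

/-- The shift `i ↦ i + 1` of `ℤ`. -/
def lam : Equiv.Perm ℤ := Equiv.addRight 1

/-- The bijection of `ℤ` that rotates each block `{kp, kp + 1, …, kp + p - 1}`. -/
def mu (p : ℕ) : Equiv.Perm ℤ where
  toFun i := if i ≡ (p : ℤ) - 1 [ZMOD p] then i - ((p : ℤ) - 1) else i + 1
  invFun i := if i ≡ 0 [ZMOD p] then i + ((p : ℤ) - 1) else i - 1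
  left_inv i := by
    dsimp only
    by_cases h : i ≡ (p : ℤ) - 1 [ZMOD p]
    · have h' : i - ((p : ℤ) - 1) ≡ 0 [ZMOD p] := by
        simpa using h.sub_right ((p : ℤ) - 1)
      rw [if_pos h, if_pos h']; ring
    · have h' : ¬ i + 1 ≡ 0 [ZMOD p] := fun h0 => h <| by
        have h1 : i ≡ 0 - 1 [ZMOD p] := by simpa using h0.sub_right 1
        exact h1.trans (by simp [Int.modEq_iff_dvd])
      rw [if_neg h, if_neg h']; ring
  right_inv i := by
    dsimp only
    by_cases h : i ≡ 0 [ZMOD p]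
    · have h' : i + ((p : ℤ) - 1) ≡ (p : ℤ) - 1 [ZMOD p] := by
        simpa using h.add_right ((p : ℤ) - 1)
      rw [if_pos h, if_pos h']; ring
    · have h' : ¬ i - 1 ≡ (p : ℤ) - 1 [ZMOD p] := fun h0 => h <| by
        have h1 : i ≡ p [ZMOD p] := by simpa using h0.add_right 1
        exact h1.trans (by simp [Int.modEq_iff_dvd])
      rw [if_neg h, if_neg h']; ring

/-- The product `λ⁻¹ μ λ`, the factors being applied from left to right. -/
def nu (p : ℕ) : Equiv.Perm ℤ := (lam.symm.trans (mu p)).trans lam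

/-- The direct product (with finite supports) of cyclic groups of order `p` indexed by `ℤ`,
written multiplicatively. -/
abbrev H (p : ℕ) : Type := Multiplicative (ℤ →₀ ZMod p)

/-- The chosen generator `c i` of the `i`-th cyclic factor. -/
noncomputable def c (p : ℕ) (i : ℤ) : H p := Multiplicative.ofAdd (Finsupp.single i 1)

/-- The automorphism of `H p` that permutes the factors according to `π`. -/
noncomputable def permAut (p : ℕ) (π : Equiv.Perm ℤ) : MulAut (H p) :=
  AddEquiv.toMultiplicative (Finsupp.domCongr π)

theorem permAut_c (p : ℕ) (π : Equiv.Perm ℤ) (i : ℤ) : permAut p π (c p i) = c p (π i) := by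
  simp [permAut, c]

/-- The automorphism `c i ↦ c (μ i)`. -/
noncomputable def alpha (p : ℕ) : MulAut (H p) := permAut p (mu p)

/-- The automorphism `c i ↦ c ((λ⁻¹ μ λ) i)`. -/
noncomputable def beta (p : ℕ) : MulAut (H p) := permAut p (nu p)

/-- The split extension of a group `N` by the cyclic group generated by an automorphism `γ`
of `N`. -/
abbrev SplitExt {N : Type*} [Group N] (γ : MulAut N) : Type _ :=
  N ⋊[(Subgroup.zpowers γ).subtype] (Subgroup.zpowers γ)

/-- The two automorphisms as a family: `false` gives `alpha p` and `true` gives `beta p`. -/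
noncomputable def autFamily (p : ℕ) : Bool → MulAut (H p)
  | false => alpha p
  | true => beta p

/-- The generalized free product of `SplitExt (alpha p)` and `SplitExt (beta p)` with `H p`
amalgamated: the pushout of the two canonical embeddings of `H p`. -/
abbrev P (p : ℕ) : Type :=
  Monoid.PushoutI (fun b : Bool => (SemidirectProduct.inl : H p →* SplitExt (autFamily p b)))

end AmalgP

/-! The amalgam is a product of `H p` and the free product of `⟨α⟩` and `⟨β⟩`, both of order `p`
(`exists_eq_base_mul_section`). An element whose free-product component is nontrivial survives under
`proj`, and is then separated by unitriangular matrices over `ZMod p`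
(`exists_hom_coprodI_zpowers`).

The remaining elements lie in `H p`. Let `c j` act on `ZMod (p ^ (n + 1))` by adding `p ^ n` on the
class of `j` modulo `p ^ n`. For `n ≠ 0` the permutations `μ` and `λ⁻¹μλ` descend to this ring and
normalise the action just as `α` and `β` do, so it extends to the amalgam (`exists_hom_extending`).
The image lies in a `p`-group (`isPGroup_treeGroup`), and a large `n` detects any given element
(`exists_levelHomH_ne_one`).

For the second claim, `μ⁻¹` followed by `λ⁻¹μλ` translates multiples of `p` by `p`, so no positive
power is trivial. -/

namespace AmalgP

open Equiv

/-! ### Cyclic shifts on the tree of residue classes -/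

section Congruence

variable {R : Type*} [CommRing R] {p : ℕ}

/-- `σ` moves the points of a residue class modulo `p ^ k` by the same amount modulo
`p ^ (k + 1)`. -/
def IsTreeLike (p : ℕ) (σ : R → R) : Prop :=
  ∀ (k : ℕ) (i j : R), (p : R) ^ k ∣ i - j → (p : R) ^ (k + 1) ∣ (σ i - i) - (σ j - j)

theorem IsTreeLike.dvd {σ : R → R} (h : IsTreeLike p σ) {k : ℕ} {i j : R}
    (hij : (p : R) ^ k ∣ i - j) : (p : R) ^ k ∣ σ i - σ j := by
  have h1 : (p : R) ^ k ∣ (σ i - i) - (σ j - j) := (pow_dvd_pow _ k.le_succ).trans (h k i j hij)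
  have h2 := dvd_add h1 hij
  rwa [show (σ i - i) - (σ j - j) + (i - j) = σ i - σ j by ring] at h2

/-- Once `i` and `j` agree modulo `p ^ k`, their displacements agree modulo `p ^ (k + 1)` and can be
subtracted from the images, which gains one level. -/
theorem IsTreeLike.dvd_of_dvd {σ : R → R} (h : IsTreeLike p σ) {k : ℕ} {i j : R}
    (hij : (p : R) ^ k ∣ σ i - σ j) : (p : R) ^ k ∣ i - j := by
  induction k with
  | zero => simp
  | succ k ih =>
    have h1 := h k i j (ih ((pow_dvd_pow _ k.le_succ).trans hij))
    have h2 := dvd_sub hij h1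
    rwa [show σ i - σ j - ((σ i - i) - (σ j - j)) = i - j by ring] at h2

theorem IsTreeLike.comp {σ τ : R → R} (hσ : IsTreeLike p σ) (hτ : IsTreeLike p τ) :
    IsTreeLike p (σ ∘ τ) := by
  intro k i j hij
  have h := dvd_add (hσ k (τ i) (τ j) (hτ.dvd hij)) (hτ k i j hij)
  simp only [Function.comp_apply]
  rwa [show σ (τ i) - τ i - (σ (τ j) - τ j) + (τ i - i - (τ j - j))
    = σ (τ i) - i - (σ (τ j) - j) by ring] at h

/-- The group of permutations of `R` acting on the tree of residue classes modulo powers of `p`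
with a cyclic shift at each vertex. -/
def treeGroup (R : Type*) [CommRing R] (p : ℕ) : Subgroup (Perm R) where
  carrier := {σ | IsTreeLike p ⇑σ}
  one_mem' := fun k i j _ => by simp
  mul_mem' := fun {σ τ} hσ hτ => IsTreeLike.comp (σ := σ) (τ := τ) hσ hτ
  inv_mem' := fun {σ} hσ k i j hij => by
    have hσ' : IsTreeLike p σ := hσ
    have h1 : (p : R) ^ k ∣ σ⁻¹ i - σ⁻¹ j := hσ'.dvd_of_dvd (by simpa using hij)
    have h2 := (hσ' k _ _ h1).neg_right
    simp only [Perm.inv_def, apply_symm_apply] at h2 ⊢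
    rwa [show -(i - σ.symm i - (j - σ.symm j)) = σ.symm i - i - (σ.symm j - j) by ring] at h2

/-- The orbit of `i` stays in one class modulo `p ^ k`, so each of the `m` steps has the same
displacement modulo `p ^ (k + 1)`. -/
theorem pow_apply_modEq {τ : Perm R} (hτ : τ ∈ treeGroup R p) {k : ℕ}
    (h : ∀ i, (p : R) ^ k ∣ τ i - i) (m : ℕ) (i : R) :
    (p : R) ^ (k + 1) ∣ (τ ^ m) i - i - m * (τ i - i) := by
  induction m with
  | zero => simp
  | succ m ih =>
    have h1 : (p : R) ^ k ∣ (τ ^ m) i - i := by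
      have := dvd_add ((pow_dvd_pow _ k.le_succ).trans ih) ((h i).mul_left (m : R))
      simpa using this
    have h2 := dvd_add (hτ k _ _ h1) ih
    rw [pow_succ' τ, Perm.mul_apply]
    convert h2 using 1
    push_cast
    ring

/-- Each `p`-th power multiplies the displacement by `p`, up to multiples of `p ^ (k + 1)`. -/
theorem pow_prime_pow_apply {σ : Perm R} (hσ : σ ∈ treeGroup R p) (k : ℕ) (i : R) :
    (p : R) ^ k ∣ (σ ^ p ^ k) i - i := by
  induction k generalizing i with
  | zero => simp
  | succ k ih =>
    have h1 := pow_apply_modEq (Subgroup.pow_mem _ hσ (p ^ k)) ih p i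
    rw [← pow_mul, ← pow_succ] at h1
    have h2 : (p : R) ^ (k + 1) ∣ p * ((σ ^ p ^ k) i - i) := by
      rw [pow_succ']; exact mul_dvd_mul_left _ (ih i)
    simpa using dvd_add h1 h2

theorem isPGroup_treeGroup {N : ℕ} (hN : (p : R) ^ N = 0) : IsPGroup p (treeGroup R p) := by
  rintro ⟨σ, hσ⟩
  refine ⟨N, Subtype.ext (Perm.ext fun i => ?_)⟩
  have h := pow_prime_pow_apply hσ N i
  rw [hN, zero_dvd_iff, sub_eq_zero] at h
  simpa using h

open Classical in
/-- The rotation of the blocks of length `p` in `R`. -/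
noncomputable def blockRot (R : Type*) [CommRing R] (p : ℕ) : Perm R where
  toFun i := i + 1 - if (p : R) ∣ i + 1 then (p : R) else 0
  invFun i := i - 1 + if (p : R) ∣ i then (p : R) else 0
  left_inv i := by
    by_cases h : (p : R) ∣ i + 1
    · have : (p : R) ∣ i + 1 - p := dvd_sub_self_right.mpr h
      simp only [if_pos h, if_pos this]; ring
    · simp [if_neg h]
  right_inv i := by
    by_cases h : (p : R) ∣ i
    · have : (p : R) ∣ i - 1 + p + 1 := by
        rw [show i - 1 + (p : R) + 1 = i + p by ring]; exact dvd_add h dvd_rfl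
      simp only [if_pos h, if_pos this]; ring
    · simp [if_neg h]

theorem blockRot_apply_of_dvd {i : R} (h : (p : R) ∣ i + 1) :
    blockRot R p i = i + 1 - p := by simp [blockRot, h]

theorem blockRot_apply_of_not_dvd {i : R} (h : ¬ (p : R) ∣ i + 1) :
    blockRot R p i = i + 1 := by simp [blockRot, h]

theorem blockRot_add {i x : R} (hx : (p : R) ∣ x) : blockRot R p (i + x) = blockRot R p i + x := by
  have h : (p : R) ∣ i + x + 1 ↔ (p : R) ∣ i + 1 := by
    rw [add_right_comm]; exact dvd_add_left hx
  by_cases hi : (p : R) ∣ i + 1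
  · rw [blockRot_apply_of_dvd hi, blockRot_apply_of_dvd (h.2 hi)]; ring
  · rw [blockRot_apply_of_not_dvd hi, blockRot_apply_of_not_dvd (mt h.1 hi)]; ring

/-- The displacement is 1 modulo `p` everywhere, and depends only on the class modulo `p`; these
settle level 0 and the higher levels. -/
theorem blockRot_mem : blockRot R p ∈ treeGroup R p := by
  intro k i j hij
  rcases k with _ | k
  · have h : ∀ i : R, (p : R) ∣ blockRot R p i - i - 1 := by
      intro i
      by_cases hi : (p : R) ∣ i + 1
      · rw [blockRot_apply_of_dvd hi, show i + 1 - (p : R) - i - 1 = -p by ring]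
        exact dvd_rfl.neg_right
      · rw [blockRot_apply_of_not_dvd hi]; ring_nf; exact dvd_zero _
    have := dvd_sub (h i) (h j)
    simpa using this
  · have h1 : (p : R) ∣ i - j := (dvd_pow_self _ k.succ_ne_zero).trans hij
    have h2 := blockRot_add (i := j) h1
    rw [add_sub_cancel] at h2
    rw [h2, show blockRot R p j + (i - j) - i - (blockRot R p j - j) = 0 by ring]
    exact dvd_zero _

theorem addRight_mem (a : R) : Equiv.addRight a ∈ treeGroup R p := fun k i j _ => by simp

end Congruence

/-! ### The permutations of the integers -/

theorem mu_eq_of_dvd {p : ℕ} {i : ℤ} (h : (p : ℤ) ∣ i + 1) : mu p i = i + 1 - p := by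
  have : i ≡ (p : ℤ) - 1 [ZMOD p] := by
    rw [Int.modEq_iff_dvd, show (p : ℤ) - 1 - i = p - (i + 1) by ring]
    exact dvd_sub dvd_rfl h
  rw [mu, Equiv.coe_fn_mk, if_pos this]; ring

theorem mu_eq_of_not_dvd {p : ℕ} {i : ℤ} (h : ¬ (p : ℤ) ∣ i + 1) : mu p i = i + 1 := by
  have : ¬ i ≡ (p : ℤ) - 1 [ZMOD p] := by
    rw [Int.modEq_iff_dvd, show (p : ℤ) - 1 - i = p - (i + 1) by ring]
    exact fun h' => h ((dvd_sub_right dvd_rfl).1 h')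
  rw [mu, Equiv.coe_fn_mk, if_neg this]

theorem mu_eq_emod {p : ℕ} (hp : 0 < p) (i : ℤ) : mu p i = p * (i / p) + (i + 1) % p := by
  have hp' : (0 : ℤ) < p := by exact_mod_cast hp
  have h0 := Int.mul_ediv_add_emod i p
  by_cases h : (p : ℤ) ∣ i + 1
  · rw [mu_eq_of_dvd h, Int.emod_eq_zero_of_dvd h]
    obtain ⟨q, hq⟩ := h
    have : i / p = q - 1 := by
      rw [show i = (p - 1) + p * (q - 1) by linarith, Int.add_mul_ediv_left _ _ hp'.ne',
        Int.ediv_eq_zero_of_lt (by omega) (by omega), zero_add]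
    rw [this]; linarith
  · rw [mu_eq_of_not_dvd h]
    have h1 : i % p < p := Int.emod_lt_of_pos _ hp'
    have h2 : 0 ≤ i % p := Int.emod_nonneg _ hp'.ne'
    have h3 : i % p + 1 ≠ p := fun h3 => h ⟨i / p + 1, by linarith⟩
    have : (i + 1) % p = i % p + 1 := by
      rw [show i + 1 = (i % p + 1) + p * (i / p) by linarith, Int.add_mul_emod_self_left]
      exact Int.emod_eq_of_lt (by omega) (by omega)
    rw [this]; linarith

theorem mu_pow_apply {p : ℕ} (hp : 0 < p) (m : ℕ) (i : ℤ) :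
    (mu p ^ m) i = p * (i / p) + (i + m) % p := by
  have hp' : (0 : ℤ) < p := by exact_mod_cast hp
  induction m with
  | zero => simpa using (Int.mul_ediv_add_emod i p).symm
  | succ m ih =>
    rw [pow_succ', Perm.mul_apply, ih, mu_eq_emod hp]
    have h1 := Int.emod_lt_of_pos (i + m) hp'
    have h2 := Int.emod_nonneg (i + m) hp'.ne'
    congr 1
    · rw [add_comm, Int.add_mul_ediv_left _ _ hp'.ne', Int.ediv_eq_zero_of_lt h2 h1, zero_add]
    · rw [add_assoc, Int.mul_add_emod_self_left, Int.emod_add_emod, add_assoc, Nat.cast_succ]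

theorem mu_pow_self {p : ℕ} (hp : 0 < p) : mu p ^ p = 1 := by
  ext i
  rw [mu_pow_apply hp, Int.add_emod_right]
  exact Int.mul_ediv_add_emod i p

theorem not_natCast_dvd_one {p : ℕ} (hp : p.Prime) : ¬ (p : ℤ) ∣ 1 := by
  exact_mod_cast hp.one_lt.ne' ∘ Nat.dvd_one.1

theorem orderOf_mu {p : ℕ} (hp : p.Prime) : orderOf (mu p) = p := by
  have := Fact.mk hp
  refine orderOf_eq_prime (mu_pow_self hp.pos) fun h => ?_
  have h1 : mu p 0 = 0 + 1 := mu_eq_of_not_dvd (by simpa using not_natCast_dvd_one hp)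
  simp [h] at h1

/-- Multiplication in `Perm` applies the right factor first, hence the reversed order. -/
theorem nu_eq (p : ℕ) : nu p = lam * mu p * lam⁻¹ := rfl

theorem orderOf_nu {p : ℕ} (hp : p.Prime) : orderOf (nu p) = p := by
  rw [nu_eq, ← MulAut.conj_apply]
  exact (MulEquiv.orderOf_eq (MulAut.conj lam) (mu p)).trans (orderOf_mu hp)

/-- The path is `i ↦ i + p - 1 ↦ i + p - 2 ↦ i + p - 1 ↦ i + p`: since `p > 1`, the point `i + p -
2` is not the end of a block. -/
theorem nu_mul_mu_inv_apply {p : ℕ} (hp : p.Prime) {i : ℤ} (h : (p : ℤ) ∣ i) :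
    (nu p * (mu p)⁻¹) i = i + p := by
  have h1 : (mu p)⁻¹ i = i + p - 1 := by
    rw [Perm.inv_eq_iff_eq, mu_eq_of_dvd] 
    · ring
    · rw [sub_add_cancel]; exact dvd_add h dvd_rfl
  have h2 : ¬ (p : ℤ) ∣ i + p - 1 - 1 + 1 := by
    rw [show i + (p : ℤ) - 1 - 1 + 1 = (i + p) - 1 by ring]
    exact fun h' => not_natCast_dvd_one hp ((dvd_sub_right (dvd_add h dvd_rfl)).1 h')
  rw [Perm.mul_apply, h1, nu_eq]
  change mu p (i + p - 1 - 1) + 1 = _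
  rw [mu_eq_of_not_dvd h2]; ring

theorem not_isOfFinOrder_nu_mul_mu_inv {p : ℕ} (hp : p.Prime) :
    ¬ IsOfFinOrder (nu p * (mu p)⁻¹) := by
  have h : ∀ m : ℕ, ((nu p * (mu p)⁻¹) ^ m) 0 = m * p := by
    intro m
    induction m with
    | zero => simp
    | succ m ih =>
      rw [pow_succ', Perm.mul_apply, ih, nu_mul_mu_inv_apply hp (dvd_mul_left _ _)]
      push_cast; ring
  rw [isOfFinOrder_iff_pow_eq_one]
  rintro ⟨m, hm, h1⟩
  have h2 := h m
  rw [h1] at h2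
  have : m = 0 ∨ p = 0 := by simpa [eq_comm] using h2
  rcases this with h | h
  · omega
  · exact hp.ne_zero h

/-- Permuting the factors is an action of the permutation group. -/
noncomputable def permAutHom (p : ℕ) : Perm ℤ →* MulAut (H p) where
  toFun := permAut p
  map_one' := by ext x; rfl
  map_mul' π ρ := by
    refine MulEquiv.ext fun x => ?_
    apply Multiplicative.toAdd.injective
    ext i
    rfl

theorem permAutHom_injective {p : ℕ} (hp : p.Prime) : Function.Injective (permAutHom p) := by
  have := Fact.mk hp
  intro π ρ h
  ext i
  have h1 : c p (π i) = c p (ρ i) := by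
    rw [← permAut_c, ← permAut_c]; exact DFunLike.congr_fun h (c p i)
  have h2 : (Finsupp.single (π i) (1 : ZMod p)) = Finsupp.single (ρ i) 1 :=
    Multiplicative.ofAdd.injective h1
  exact (Finsupp.single_left_inj one_ne_zero).1 h2

theorem orderOf_autFamily {p : ℕ} (hp : p.Prime) (b : Bool) : orderOf (autFamily p b) = p := by
  cases b
  · exact (orderOf_injective _ (permAutHom_injective hp) (mu p)).trans (orderOf_mu hp)
  · exact (orderOf_injective _ (permAutHom_injective hp) (nu p)).trans (orderOf_nu hp)

theorem not_isOfFinOrder_alpha_symm_trans_beta {p : ℕ} (hp : p.Prime) :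
    ¬ IsOfFinOrder (G := MulAut (H p)) ((alpha p).symm.trans (beta p)) := by
  have h : (alpha p).symm.trans (beta p) = permAutHom p (nu p * (mu p)⁻¹) := by
    rw [map_mul, map_inv]; rfl
  rw [h, (permAutHom_injective hp).isOfFinOrder_iff]
  exact not_isOfFinOrder_nu_mul_mu_inv hp

open Equiv

/-! ### The action of `H p` on `ZMod (p ^ (n + 1))` -/

section Level

variable {p : ℕ} (n : ℕ)

/-- Multiplication by `p ^ n`, from `ZMod p` to `ZMod (p ^ (n + 1))`. -/
def levelHom (p n : ℕ) : ZMod p →+ ZMod (p ^ (n + 1)) :=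
  ZMod.lift p ⟨zmultiplesHom _ ((p : ZMod (p ^ (n + 1))) ^ n), by
    rw [zmultiplesHom_apply, natCast_zsmul, nsmul_eq_mul, ← pow_succ']
    exact_mod_cast ZMod.natCast_self (p ^ (n + 1))⟩

theorem levelHom_intCast (x : ℤ) : levelHom p n x = x * (p : ZMod (p ^ (n + 1))) ^ n := by
  rw [levelHom, ZMod.lift_coe]
  simp

theorem levelHom_ne_zero (hp : p.Prime) {t : ZMod p} (ht : t ≠ 0) : levelHom p n t ≠ 0 := by
  obtain ⟨x, rfl⟩ := ZMod.intCast_surjective t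
  rw [levelHom_intCast]
  intro h
  have h1 : ((x * (p : ℤ) ^ n : ℤ) : ZMod (p ^ (n + 1))) = 0 := by
    push_cast; exact h
  rw [ZMod.intCast_zmod_eq_zero_iff_dvd, Nat.cast_pow, pow_succ'] at h1
  refine ht ((ZMod.intCast_zmod_eq_zero_iff_dvd _ _).2 (Int.dvd_of_mul_dvd_mul_right ?_ h1))
  exact pow_ne_zero _ (by exact_mod_cast hp.ne_zero)

theorem pow_dvd_levelHom (t : ZMod p) : (p : ZMod (p ^ (n + 1))) ^ n ∣ levelHom p n t := by
  obtain ⟨x, rfl⟩ := ZMod.intCast_surjective t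
  rw [levelHom_intCast]
  exact dvd_mul_left _ _

theorem pow_dvd_intCast_iff {k : ℕ} (hk : k ≤ n + 1) (x : ℤ) :
    (p : ZMod (p ^ (n + 1))) ^ k ∣ (x : ZMod (p ^ (n + 1))) ↔ (p : ℤ) ^ k ∣ x := by
  constructor
  · intro h
    have h1 := map_dvd (ZMod.castHom (pow_dvd_pow p hk) (ZMod (p ^ k))) h
    have h2 : ((p : ZMod (p ^ k)) ^ k) = 0 := by exact_mod_cast ZMod.natCast_self (p ^ k)
    rw [map_pow, map_natCast, map_intCast, h2, zero_dvd_iff, ZMod.intCast_zmod_eq_zero_iff_dvd] at h1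
    exact_mod_cast h1
  · intro h
    simpa using map_dvd (Int.castRingHom (ZMod (p ^ (n + 1)))) h

open Classical in
/-- The element of `p ^ n ZMod (p ^ (n + 1))` given by the sum of the values of `h` on the
residue class of `i` modulo `p ^ n`. -/
noncomputable def levelSum (h : ℤ →₀ ZMod p) (i : ZMod (p ^ (n + 1))) : ZMod (p ^ (n + 1)) :=
  h.sum fun j t => if (p : ZMod (p ^ (n + 1))) ^ n ∣ i - j then levelHom p n t else 0

theorem levelSum_zero (i : ZMod (p ^ (n + 1))) : levelSum n (0 : ℤ →₀ ZMod p) i = 0 :=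
  Finsupp.sum_zero_index

theorem levelSum_add (h h' : ℤ →₀ ZMod p) (i : ZMod (p ^ (n + 1))) :
    levelSum n (h + h') i = levelSum n h i + levelSum n h' i := by
  classical
  refine Finsupp.sum_add_index' (fun j => ?_) fun j t t' => ?_
  · simp
  · split_ifs <;> simp

theorem pow_dvd_levelSum (h : ℤ →₀ ZMod p) (i : ZMod (p ^ (n + 1))) :
    (p : ZMod (p ^ (n + 1))) ^ n ∣ levelSum n h i := by
  refine Finset.dvd_sum fun j _ => ?_
  dsimp only
  split_ifs
  · exact pow_dvd_levelHom n _
  · exact dvd_zero _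

theorem levelSum_congr (h : ℤ →₀ ZMod p) {i i' : ZMod (p ^ (n + 1))}
    (hi : (p : ZMod (p ^ (n + 1))) ^ n ∣ i - i') : levelSum n h i = levelSum n h i' := by
  refine Finsupp.sum_congr fun j _ => ?_
  have : (p : ZMod (p ^ (n + 1))) ^ n ∣ i - j ↔ (p : ZMod (p ^ (n + 1))) ^ n ∣ i' - j := by
    rw [show i - (j : ZMod (p ^ (n + 1))) = (i - i') + (i' - j) by ring]
    exact dvd_add_right hi
  classical exact if_congr this rfl rfl

/-- Translation by a multiple of `p ^ n` preserves classes modulo `p ^ n`; this makes `levelPerm`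
multiplicative. -/
theorem levelSum_add_levelSum (h h' : ℤ →₀ ZMod p) (i : ZMod (p ^ (n + 1))) :
    levelSum n h (i + levelSum n h' i) = levelSum n h i :=
  levelSum_congr n h (by simpa using pow_dvd_levelSum n h' i)

/-- Since `τ` preserves and reflects congruence modulo `p ^ n`, `c (π j)` contributes at `τ i`
exactly when `c j` contributes at `i`. -/
theorem levelSum_domCongr {π : Perm ℤ} {τ : Perm (ZMod (p ^ (n + 1)))}
    (hτ : τ ∈ treeGroup (ZMod (p ^ (n + 1))) p) (hπ : ∀ j : ℤ, ((π j : ℤ) : ZMod (p ^ (n + 1))) = τ j)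
    (h : ℤ →₀ ZMod p) (i : ZMod (p ^ (n + 1))) :
    levelSum n (Finsupp.domCongr π h) (τ i) = levelSum n h i := by
  have hτ' : IsTreeLike p τ := hτ
  unfold levelSum
  rw [Finsupp.domCongr_apply, Finsupp.equivMapDomain_eq_mapDomain,
    Finsupp.sum_mapDomain_index_inj π.injective]
  refine Finsupp.sum_congr fun j _ => ?_
  have : (p : ZMod (p ^ (n + 1))) ^ n ∣ τ i - (π j : ℤ) ↔ (p : ZMod (p ^ (n + 1))) ^ n ∣ i - j := by
    rw [hπ]
    exact ⟨fun h => hτ'.dvd_of_dvd h, fun h => hτ'.dvd h⟩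
  classical exact if_congr this rfl rfl

/-- The action of `H p` on `ZMod (p ^ (n + 1))` where `c j` adds `p ^ n` on the residue class of
`j` modulo `p ^ n`. -/
noncomputable def levelPerm (p n : ℕ) : H p →* Perm (ZMod (p ^ (n + 1))) :=
  MonoidHom.toHomPerm
    { toFun := fun h i => i + levelSum n h.toAdd i
      map_one' := by
        funext i
        exact (congrArg (i + ·) (levelSum_zero n i)).trans (add_zero i)
      map_mul' := fun h h' => by
        funext i
        change i + levelSum n (h.toAdd + h'.toAdd) i = (i + levelSum n h'.toAdd i) +
          levelSum n h.toAdd (i + levelSum n h'.toAdd i)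
        rw [levelSum_add_levelSum, levelSum_add]
        ring }

theorem levelPerm_apply (h : H p) (i : ZMod (p ^ (n + 1))) :
    levelPerm p n h i = i + levelSum n h.toAdd i := rfl

theorem levelPerm_mem (h : H p) : levelPerm p n h ∈ treeGroup (ZMod (p ^ (n + 1))) p := by
  intro k i j hij
  rw [levelPerm_apply, levelPerm_apply, add_sub_cancel_left, add_sub_cancel_left]
  -- Below level `n` the displacements vanish modulo `p ^ (k + 1)`; from level `n` on they are
  -- constant on classes.
  rcases lt_or_ge k n with hk | hk
  · exact (pow_dvd_pow _ hk).trans (dvd_sub (pow_dvd_levelSum n _ _) (pow_dvd_levelSum n _ _))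
  · rw [levelSum_congr n _ ((pow_dvd_pow _ hk).trans hij), sub_self]
    exact dvd_zero _

/-- `levelPerm` with values in the tree group. -/
noncomputable def levelHomH (p n : ℕ) : H p →* treeGroup (ZMod (p ^ (n + 1))) p :=
  (levelPerm p n).codRestrict _ (levelPerm_mem n)

/-- `τ` is a permutation of `ZMod (p ^ (n + 1))` in the tree group that lifts to the permutation
`π` of the integers, and commutes with the addition of multiples of `p ^ n`. -/
structure IsLevelMap (π : Perm ℤ) (τ : treeGroup (ZMod (p ^ (n + 1))) p) : Prop where
  intCast (j : ℤ) : ((π j : ℤ) : ZMod (p ^ (n + 1))) = τ.1 j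
  add (i x : ZMod (p ^ (n + 1))) : (p : ZMod (p ^ (n + 1))) ^ n ∣ x → τ.1 (i + x) = τ.1 i + x

variable {n}

theorem IsLevelMap.mul {π ρ : Perm ℤ} {τ υ : treeGroup (ZMod (p ^ (n + 1))) p}
    (hπ : IsLevelMap n π τ) (hρ : IsLevelMap n ρ υ) : IsLevelMap n (π * ρ) (τ * υ) where
  intCast j := by simp [hπ.intCast, hρ.intCast]
  add i x hx := by simp [hπ.add _ _ hx, hρ.add _ _ hx]

theorem IsLevelMap.inv {π : Perm ℤ} {τ : treeGroup (ZMod (p ^ (n + 1))) p}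
    (hπ : IsLevelMap n π τ) : IsLevelMap n π⁻¹ τ⁻¹ where
  intCast j := by
    have := hπ.intCast (π⁻¹ j)
    simp only [Perm.inv_def, apply_symm_apply] at this
    rw [this]
    simp
  add i x hx := by
    have := hπ.add (τ.1.symm i) x hx
    simp only [apply_symm_apply] at this
    simp [← this]

theorem IsLevelMap.pow_eq_one {π : Perm ℤ} {τ : treeGroup (ZMod (p ^ (n + 1))) p}
    (hπ : IsLevelMap n π τ) {m : ℕ} (hm : π ^ m = 1) : τ ^ m = 1 := by
  have h : ∀ (m : ℕ) (j : ℤ), (((π ^ m) j : ℤ) : ZMod (p ^ (n + 1))) = (τ.1 ^ m) j := by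
    intro m
    induction m with
    | zero => simp
    | succ m ih =>
      intro j
      rw [pow_succ' π, pow_succ' τ.1, Perm.mul_apply, Perm.mul_apply, hπ.intCast, ih]
  refine Subtype.ext (Perm.ext fun i => ?_)
  obtain ⟨j, rfl⟩ := ZMod.intCast_surjective i
  have := h m j
  rw [hm] at this
  simpa using this.symm

/-- Conjugation by `τ` thus induces `permAut p π`, the compatibility needed to extend `levelHomH` to
the amalgam. -/
theorem IsLevelMap.mul_levelHomH {π : Perm ℤ} {τ : treeGroup (ZMod (p ^ (n + 1))) p}
    (hπ : IsLevelMap n π τ) (h : H p) :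
    τ * levelHomH p n h = levelHomH p n (permAut p π h) * τ := by
  refine Subtype.ext (Perm.ext fun i => ?_)
  change τ.1 (i + levelSum n h.toAdd i) = τ.1 i + levelSum n (Finsupp.domCongr π h.toAdd) (τ.1 i)
  rw [hπ.add _ _ (pow_dvd_levelSum n _ _), levelSum_domCongr n τ.2 hπ.intCast]

theorem isLevelMap_lam : IsLevelMap n lam (⟨Equiv.addRight 1, addRight_mem 1⟩ :
    treeGroup (ZMod (p ^ (n + 1))) p) where
  intCast j := by simp [lam]
  add i x _ := by simp [add_right_comm]

theorem isLevelMap_mu (hn : n ≠ 0) : IsLevelMap n (mu p) (⟨blockRot _ p, blockRot_mem⟩ :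
    treeGroup (ZMod (p ^ (n + 1))) p) where
  intCast j := by
    have h := pow_dvd_intCast_iff (p := p) n (k := 1) (by omega) (j + 1)
    rw [pow_one, pow_one] at h
    push_cast at h
    by_cases hj : (p : ℤ) ∣ j + 1
    · rw [mu_eq_of_dvd hj]
      change _ = blockRot (ZMod (p ^ (n + 1))) p j
      rw [blockRot_apply_of_dvd (h.2 hj)]
      push_cast; rfl
    · rw [mu_eq_of_not_dvd hj]
      change _ = blockRot (ZMod (p ^ (n + 1))) p j
      rw [blockRot_apply_of_not_dvd (mt h.1 hj)]
      push_cast; rfl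
  -- Here `n ≠ 0` is needed: block rotation commutes only with translations by multiples of `p`.
  add i x hx := blockRot_add ((dvd_pow_self _ hn).trans hx)

theorem exists_isLevelMap (p : ℕ) (hn : n ≠ 0) (b : Bool) : ∃ (π : Perm ℤ)
    (τ : treeGroup (ZMod (p ^ (n + 1))) p), autFamily p b = permAut p π ∧ IsLevelMap n π τ := by
  cases b
  · exact ⟨_, _, rfl, isLevelMap_mu hn⟩
  · exact ⟨_, _, rfl, (isLevelMap_lam.mul (isLevelMap_mu hn)).mul isLevelMap_lam.inv⟩

theorem exists_levelHomH_ne_one (hp : p.Prime) {h : H p} (hh : h ≠ 1) :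
    ∃ n ≠ 0, levelHomH p n h ≠ 1 := by
  have h0 : h.toAdd ≠ 0 := hh
  obtain ⟨j, hj⟩ := Finsupp.ne_iff.1 h0
  obtain ⟨n, hn⟩ : ∃ n : ℕ, ∀ i ∈ h.toAdd.support, |j - i| < n := by
    refine ⟨(∑ i ∈ h.toAdd.support, |j - i|).toNat + 1, fun i hi => ?_⟩
    have := Finset.single_le_sum (f := fun i => |j - i|) (fun i _ => abs_nonneg _) hi
    omega
  have hlt : ((n + 1 : ℕ) : ℤ) < (p : ℤ) ^ (n + 1) := by
    exact_mod_cast Nat.lt_pow_self hp.one_lt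
  -- As `p ^ (n + 1)` exceeds the distance from `j` to every support point, only `j` itself
  -- contributes at `j`.
  refine ⟨n + 1, n.succ_ne_zero, fun h1 => ?_⟩
  have h2 : (j : ZMod (p ^ (n + 1 + 1))) + levelSum (n + 1) h.toAdd j = j := by
    have := congrArg (fun σ => σ.1 (j : ZMod (p ^ (n + 1 + 1)))) h1
    exact this
  rw [add_eq_left, levelSum, Finsupp.sum, Finset.sum_eq_single j] at h2
  · rw [sub_self, if_pos (dvd_zero _)] at h2
    exact levelHom_ne_zero (n + 1) hp hj h2
  · intro i hi hij
    refine if_neg fun hd => hij ?_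
    rw [← Int.cast_sub, pow_dvd_intCast_iff (n + 1) (Nat.le_succ _)] at hd
    have h3 := Int.eq_zero_of_abs_lt_dvd hd ((hn i hi).trans (by push_cast at hlt ⊢; omega))
    omega
  · intro hj'
    exact absurd (Finsupp.mem_support_iff.2 hj) hj'

end Level

open Monoid

/-- The homomorphism from the cyclic group `⟨γ⟩` sending `γ` to `g`. -/
noncomputable def zpowersLift {G K : Type*} [Group G] [Group K] {γ : G} {g : K}
    (h : orderOf g ∣ orderOf γ) : Subgroup.zpowers γ →* K :=
  monoidHomOfForallMemZpowers (g := (⟨γ, Subgroup.mem_zpowers γ⟩ : Subgroup.zpowers γ)) (g' := g)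
    (by
      rintro ⟨x, k, rfl⟩
      exact ⟨k, Subtype.ext (by simp)⟩)
    (by simpa using h)

theorem zpowersLift_gen {G K : Type*} [Group G] [Group K] {γ : G} {g : K}
    (h : orderOf g ∣ orderOf γ) : zpowersLift h ⟨γ, Subgroup.mem_zpowers γ⟩ = g :=
  monoidHomOfForallMemZpowers_apply_gen _ _

/-! ### Unitriangular matrices over a ring of characteristic `p` -/

section Unitriangular

variable {F : Type*} [CommRing F] {n : ℕ}

/-- Strictly upper triangular matrices. -/
def IsStrictUpper (M : Matrix (Fin n) (Fin n) F) : Prop := ∀ i j, j ≤ i → M i j = 0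

theorem IsStrictUpper.mul {M N : Matrix (Fin n) (Fin n) F} (hM : IsStrictUpper M)
    (hN : IsStrictUpper N) : IsStrictUpper (M * N) := by
  intro i j hij
  rw [Matrix.mul_apply]
  refine Finset.sum_eq_zero fun l _ => ?_
  rcases le_or_gt l i with h | h
  · rw [hM i l h, zero_mul]
  · rw [hN l j (hij.trans h.le), mul_zero]

theorem IsStrictUpper.add {M N : Matrix (Fin n) (Fin n) F} (hM : IsStrictUpper M)
    (hN : IsStrictUpper N) : IsStrictUpper (M + N) := fun i j hij => by
  rw [Matrix.add_apply, hM i j hij, hN i j hij, add_zero]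

theorem IsStrictUpper.pow_apply {M : Matrix (Fin n) (Fin n) F} (hM : IsStrictUpper M) (k : ℕ)
    (i j : Fin n) (h : (j : ℕ) < i + k) : (M ^ k) i j = 0 := by
  induction k generalizing j with
  | zero =>
    rw [pow_zero, Matrix.one_apply_ne]
    rintro rfl
    simp at h
  | succ k ih =>
    rw [pow_succ, Matrix.mul_apply]
    refine Finset.sum_eq_zero fun l _ => ?_
    by_cases hl : (l : ℕ) < i + k
    · rw [ih l hl, zero_mul]
    · rw [hM l j (Fin.le_def.2 (by omega)), mul_zero]

theorem IsStrictUpper.pow_eq_zero {M : Matrix (Fin n) (Fin n) F} (hM : IsStrictUpper M) {k : ℕ}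
    (hk : n ≤ k) : M ^ k = 0 := by
  ext i j
  exact hM.pow_apply k i j (by omega)

/-- The group of upper unitriangular matrices. -/
def unitriangular (n : ℕ) (F : Type*) [CommRing F] : Subgroup (Matrix (Fin n) (Fin n) F)ˣ where
  carrier := {u | IsStrictUpper ((u : Matrix (Fin n) (Fin n) F) - 1) ∧
    IsStrictUpper (((u⁻¹ : (Matrix (Fin n) (Fin n) F)ˣ) : Matrix (Fin n) (Fin n) F) - 1)}
  one_mem' := by simp [IsStrictUpper]
  inv_mem' := fun h => ⟨h.2, by simpa using h.1⟩
  mul_mem' := by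
    have key : ∀ M N : Matrix (Fin n) (Fin n) F, IsStrictUpper (M - 1) → IsStrictUpper (N - 1) →
        IsStrictUpper (M * N - 1) := by
      intro M N hM hN
      have := ((hM.mul hN).add hM).add hN
      rwa [show (M - 1) * (N - 1) + (M - 1) + (N - 1) = M * N - 1 by noncomm_ring] at this
    intro u v hu hv
    refine ⟨?_, ?_⟩
    · rw [Units.val_mul]; exact key _ _ hu.1 hv.1
    · rw [mul_inv_rev, Units.val_mul]; exact key _ _ hv.2 hu.2

theorem isPGroup_unitriangular (p : ℕ) [Fact p.Prime] [CharP F p] :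
    IsPGroup p (unitriangular n F) := by
  rintro ⟨u, hu⟩
  -- Matrices of size 0 form the zero ring, which does not have characteristic `p`.
  rcases n with _ | n
  · exact ⟨0, Subsingleton.elim _ _⟩
  have : CharP (Matrix (Fin (n + 1)) (Fin (n + 1)) F) p := inferInstance
  refine ⟨n + 1, Subtype.ext (Units.ext ?_)⟩
  have h := hu.1.pow_eq_zero (k := p ^ (n + 1)) (Nat.lt_pow_self (Fact.out : p.Prime).one_lt).le
  rw [sub_pow_char_pow_of_commute _ _ (Commute.one_right _), one_pow, sub_eq_zero] at h
  simpa using h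

/-- The sum of the matrix units `E i (i + 1)` with `i` of parity `b`. -/
def stepMatrix (n : ℕ) (F : Type*) [CommRing F] (b : Bool) : Matrix (Fin n) (Fin n) F :=
  Matrix.of fun i j => if (j : ℕ) = i + 1 ∧ (i : ℕ).bodd = b then 1 else 0

theorem stepMatrix_apply (b : Bool) (i j : Fin n) : stepMatrix n F b i j =
    if (j : ℕ) = i + 1 ∧ (i : ℕ).bodd = b then 1 else 0 := rfl

theorem isStrictUpper_stepMatrix (b : Bool) : IsStrictUpper (stepMatrix n F b) := by
  intro i j hij
  rw [stepMatrix_apply, if_neg]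
  rintro ⟨h, -⟩
  have := Fin.le_def.1 hij
  omega

/-- Consecutive indices have opposite parity, so two steps of the same type never compose. -/
theorem stepMatrix_mul_self (b : Bool) : stepMatrix n F b * stepMatrix n F b = 0 := by
  ext i j
  rw [Matrix.mul_apply]
  refine Finset.sum_eq_zero fun l _ => ?_
  rw [stepMatrix_apply, stepMatrix_apply]
  split_ifs with h1 h2 <;> simp
  have h3 := h2.2
  rw [h1.1, Nat.bodd_succ, h1.2] at h3
  simp at h3

/-- The unit `1 + X`, where `X` is the matrix `stepMatrix n F b`. -/
def stepUnit (n : ℕ) (F : Type*) [CommRing F] (b : Bool) : (Matrix (Fin n) (Fin n) F)ˣ where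
  val := 1 + stepMatrix n F b
  inv := 1 - stepMatrix n F b
  val_inv := by
    rw [show (1 + stepMatrix n F b) * (1 - stepMatrix n F b)
      = 1 - stepMatrix n F b * stepMatrix n F b by noncomm_ring, stepMatrix_mul_self, sub_zero]
  inv_val := by
    rw [show (1 - stepMatrix n F b) * (1 + stepMatrix n F b)
      = 1 - stepMatrix n F b * stepMatrix n F b by noncomm_ring, stepMatrix_mul_self, sub_zero]

theorem stepUnit_mem (b : Bool) : stepUnit n F b ∈ unitriangular n F := by
  refine ⟨?_, ?_⟩
  · change IsStrictUpper (1 + stepMatrix n F b - 1)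
    rw [add_sub_cancel_left]
    exact isStrictUpper_stepMatrix b
  · change IsStrictUpper (1 - stepMatrix n F b - 1)
    intro i j hij
    simp [isStrictUpper_stepMatrix b i j hij]

theorem stepUnit_pow (b : Bool) (m : ℕ) :
    ((stepUnit n F b ^ m : (Matrix (Fin n) (Fin n) F)ˣ) : Matrix (Fin n) (Fin n) F)
      = 1 + (m : F) • stepMatrix n F b := by
  induction m with
  | zero => simp
  | succ m ih =>
    rw [pow_succ, Units.val_mul, ih]
    change (1 + (m : F) • stepMatrix n F b) * (1 + stepMatrix n F b) = _
    rw [mul_add, mul_one, add_mul, one_mul, smul_mul_assoc, stepMatrix_mul_self, smul_zero,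
      add_zero, Nat.cast_succ, add_smul, one_smul, add_assoc]

theorem stepMatrix_mulVec (b : Bool) (v : Fin n → F) (i j : Fin n) (hij : (j : ℕ) = i + 1) :
    (stepMatrix n F b).mulVec v i = if (i : ℕ).bodd = b then v j else 0 := by
  rw [Matrix.mulVec, dotProduct, Finset.sum_eq_single j]
  · simp [stepMatrix_apply, hij]
  · intro l _ hl
    rw [stepMatrix_apply, if_neg, zero_mul]
    rintro ⟨h, -⟩
    exact hl (Fin.ext (h.trans hij.symm))
  · simp

end Unitriangular

/-! ### Separating reduced words by matrices -/

section FreeProduct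

variable {p : ℕ} {G : Bool → Type*} [∀ b, Group (G b)] {n : ℕ}
  {f : ∀ b, G b →* (Matrix (Fin (n + 1)) (Fin (n + 1)) (ZMod p))ˣ}

/-- The image of the last basis vector under a reduced word of length `k` vanishes before the
position `n - k`, and not at this position if its parity is the index of the first letter. -/
theorem lift_word_mulVec [Fact p.Prime]
    (hf : ∀ b, ∀ g : G b, g ≠ 1 → ∃ e : ZMod p, e ≠ 0 ∧
      (f b g : Matrix (Fin (n + 1)) (Fin (n + 1)) (ZMod p)) = 1 + e • stepMatrix (n + 1) (ZMod p) b)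
    (w : CoprodI.Word G) (hw : w.toList.length ≤ n) :
    (∀ j : Fin (n + 1), (j : ℕ) + w.toList.length < n →
      ((CoprodI.lift f w.prod : (Matrix (Fin (n + 1)) (Fin (n + 1)) (ZMod p))ˣ) :
        Matrix (Fin (n + 1)) (Fin (n + 1)) (ZMod p)).mulVec (Pi.single (Fin.last n) 1) j = 0) ∧
    (∀ j : Fin (n + 1), (j : ℕ) + w.toList.length = n →
      (∀ b, w.fstIdx = some b → (j : ℕ).bodd = b) →
      ((CoprodI.lift f w.prod : (Matrix (Fin (n + 1)) (Fin (n + 1)) (ZMod p))ˣ) :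
        Matrix (Fin (n + 1)) (Fin (n + 1)) (ZMod p)).mulVec (Pi.single (Fin.last n) 1) j ≠ 0) := by
  induction w using CoprodI.Word.consRecOn with
  | empty =>
    refine ⟨fun j hj => ?_, fun j hj _ => ?_⟩
    · have : j ≠ Fin.last n := by
        rintro rfl
        simp at hj
      simp [this]
    · have : j = Fin.last n := Fin.ext (by simpa [CoprodI.Word.empty] using hj)
      simp [this]
  | cons b m w h1 h2 ih =>
    have hlen : (CoprodI.Word.cons m w h1 h2).toList.length = w.toList.length + 1 := rfl
    rw [hlen] at hw ⊢
    obtain ⟨ih1, ih2⟩ := ih (by omega)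
    obtain ⟨e, he, hfe⟩ := hf b m h2
    -- A new first letter adds to coordinate `j` of parity `b` the multiple by `e` of coordinate `j
    -- + 1`.
    have key : ∀ j j' : Fin (n + 1), (j' : ℕ) = j + 1 → ((CoprodI.lift f
        (CoprodI.Word.cons m w h1 h2).prod : (Matrix (Fin (n + 1)) (Fin (n + 1)) (ZMod p))ˣ) :
        Matrix (Fin (n + 1)) (Fin (n + 1)) (ZMod p)).mulVec (Pi.single (Fin.last n) 1) j =
        (CoprodI.lift f w.prod : Matrix (Fin (n + 1)) (Fin (n + 1)) (ZMod p)).mulVec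
          (Pi.single (Fin.last n) 1) j + e * if (j : ℕ).bodd = b then
        (CoprodI.lift f w.prod : Matrix (Fin (n + 1)) (Fin (n + 1)) (ZMod p)).mulVec
          (Pi.single (Fin.last n) 1) j' else 0 := by
      intro j j' hj
      rw [CoprodI.Word.prod_cons, map_mul, CoprodI.lift_of, Units.val_mul, hfe,
        ← Matrix.mulVec_mulVec, Matrix.add_mulVec, Matrix.one_mulVec, Pi.add_apply,
        Matrix.smul_mulVec, Pi.smul_apply, smul_eq_mul, stepMatrix_mulVec _ _ j j' hj]
    refine ⟨fun j hj => ?_, fun j hj hb => ?_⟩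
    · rw [key j ⟨j + 1, by omega⟩ rfl, ih1 j (by omega),
        ih1 ⟨j + 1, by omega⟩ (by simp only; omega)]
      simp
    · have hjb : (j : ℕ).bodd = b := hb b (by simp)
      rw [key j ⟨j + 1, by omega⟩ rfl, ih1 j (by omega), if_pos hjb, zero_add]
      refine mul_ne_zero he (ih2 ⟨j + 1, by omega⟩ (by simp only; omega) fun b' hb' => ?_)
      -- Adjacent letters of a reduced word have different indices, matching the parities of `j` and
      -- `j + 1`.
      have hne : b' ≠ b := fun h => h1 (h ▸ hb')
      rw [Nat.bodd_succ, hjb]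
      revert hne
      cases b <;> cases b' <;> simp

end FreeProduct

/-- Elements of the free product of two groups `⟨γ b⟩` of order `p` are separated by finite
`p`-groups. -/
theorem exists_hom_coprodI_zpowers {p : ℕ} [Fact p.Prime] {G : Type*} [Group G] {γ : Bool → G}
    (hγ : ∀ b, orderOf (γ b) = p) {w : CoprodI fun b => Subgroup.zpowers (γ b)} (hw : w ≠ 1) :
    ∃ (n : ℕ) (f : CoprodI (fun b => Subgroup.zpowers (γ b)) →* unitriangular n (ZMod p)),
      f w ≠ 1 := by
  classical
  obtain ⟨w, rfl⟩ := CoprodI.Word.equiv.symm.surjective w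
  change w.prod ≠ 1 at hw
  have hord : ∀ n b, orderOf (⟨stepUnit (n + 1) (ZMod p) b, stepUnit_mem b⟩ :
      unitriangular (n + 1) (ZMod p)) ∣ orderOf (γ b) := fun n b => by
    rw [hγ, orderOf_dvd_iff_pow_eq_one]
    refine Subtype.ext (Units.ext ?_)
    rw [Subgroup.coe_pow, stepUnit_pow]
    simp
  set k := w.toList.length with hk
  have hk0 : 0 < k := by
    refine List.length_pos_iff.2 fun h => hw ?_
    simp [CoprodI.Word.prod, h]
  obtain ⟨a, hwa⟩ : ∃ a : Bool, ∀ b, w.fstIdx = some b → a = b := by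
    rcases h : w.fstIdx with _ | a
    · exact ⟨true, by simp⟩
    · exact ⟨a, by simp⟩
  obtain ⟨j, hj⟩ : ∃ j : ℕ, j.bodd = a := by
    cases a
    · exact ⟨0, rfl⟩
    · exact ⟨1, rfl⟩
  -- With this size, the word carries the last basis vector, at position `j + k`, to a vector with
  -- nonzero coordinate `j`; as `k > 0`, the identity does not.
  refine ⟨j + k + 1, CoprodI.lift fun b => zpowersLift (hord (j + k) b), fun h => ?_⟩
  set g : ∀ b, Subgroup.zpowers (γ b) →*
      (Matrix (Fin (j + k + 1)) (Fin (j + k + 1)) (ZMod p))ˣ :=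
    fun b => (Subgroup.subtype _).comp (zpowersLift (hord (j + k) b)) with hg
  have hlift : CoprodI.lift g w.prod = 1 := by
    have h1 : CoprodI.lift g = (Subgroup.subtype _).comp
        (CoprodI.lift fun b => zpowersLift (hord (j + k) b)) := by
      ext b x
      simp [hg]
    have h2 : (CoprodI.lift fun b => zpowersLift (hord (j + k) b)) w.prod = 1 := h
    rw [h1, MonoidHom.comp_apply, h2, map_one]
  refine (lift_word_mulVec (f := g) ?_ w (by omega)).2 ⟨j, by omega⟩ (by simp only; omega)
    (fun b hb => hj.trans (hwa b hb)) ?_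
  · rintro b ⟨x, hx⟩ hx1
    have hfin : IsOfFinOrder (γ b) :=
      orderOf_pos_iff.1 ((hγ b).symm ▸ (Fact.out : p.Prime).pos)
    obtain ⟨m, rfl⟩ := hfin.mem_powers_iff_mem_zpowers.2 hx
    refine ⟨m, fun hm => hx1 (Subtype.ext ?_), ?_⟩
    · rw [ZMod.natCast_eq_zero_iff, ← hγ b] at hm
      exact orderOf_dvd_iff_pow_eq_one.1 hm
    · rw [← stepUnit_pow]
      have : (⟨(fun m => γ b ^ m) m, hx⟩ : Subgroup.zpowers (γ b))
        = ⟨γ b, Subgroup.mem_zpowers _⟩ ^ m := rfl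
      rw [this, map_pow, hg, MonoidHom.comp_apply, zpowersLift_gen]
      rfl
  · rw [hlift, Units.val_one, Matrix.one_mulVec, Pi.single_eq_of_ne]
    intro h
    have := congrArg Fin.val h
    simp at this
    omega

open Monoid

/-- It suffices to separate the elements by homomorphisms into finite `p`-groups. -/
theorem exists_surjective_of_hom.{u, v} {p : ℕ} {G : Type u} {K : Type v} [Group G] [Group K]
    [Finite K]
    (hK : IsPGroup p K) {f : G →* K} {x : G} (hx : f x ≠ 1) :
    ∃ (Q : Type v) (_ : Group Q) (σ : G →* Q),
      Finite Q ∧ IsPGroup p Q ∧ Function.Surjective σ ∧ σ x ≠ 1 :=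
  ⟨f.range, inferInstance, f.rangeRestrict, inferInstance, hK.to_subgroup _,
    f.rangeRestrict_surjective, fun h => hx (congrArg Subtype.val h)⟩

/-! ### Amalgams of split extensions over the common kernel -/

section SplitAmalgam

variable {N : Type*} [Group N] (γ : Bool → MulAut N)

/-- The generalized free product of the split extensions of `N` by the automorphisms `γ b`. -/
abbrev SplitAmalgam : Type _ :=
  PushoutI (fun b : Bool => (SemidirectProduct.inl : N →* SplitExt (γ b)))

/-- The free product of the complements. -/
abbrev FreeComplement : Type _ := CoprodI fun b : Bool => Subgroup.zpowers (γ b)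

namespace SplitAmalgam

/-- The inclusion of the free product of the complements. -/
def sectionHom : FreeComplement γ →* SplitAmalgam γ :=
  CoprodI.lift fun b => (PushoutI.of b).comp SemidirectProduct.inr

/-- The projection onto the free product of the complements. -/
def proj : SplitAmalgam γ →* FreeComplement γ :=
  PushoutI.lift (fun b => CoprodI.of.comp SemidirectProduct.rightHom) 1 fun b => by
    ext x; simp

theorem proj_base (x : N) : proj γ (PushoutI.base _ x) = 1 := by simp [proj]

theorem proj_section (w : FreeComplement γ) : proj γ (sectionHom γ w) = w := by
  have : (proj γ).comp (sectionHom γ) = MonoidHom.id _ := by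
    ext b x
    simp [proj, sectionHom]
  exact DFunLike.congr_fun this w

/-- Each letter acts on `N` by conjugation as the automorphism it is; words follow by induction. -/
theorem exists_section_mul_base (w : FreeComplement γ) (x : N) :
    ∃ y : N, sectionHom γ w * PushoutI.base _ x = PushoutI.base _ y * sectionHom γ w := by
  induction w using CoprodI.induction_on generalizing x with
  | one => exact ⟨x, by simp⟩
  | of b g =>
    refine ⟨g.1 x, ?_⟩
    rw [sectionHom, CoprodI.lift_of, MonoidHom.comp_apply,
      ← PushoutI.of_apply_eq_base (fun b : Bool => (SemidirectProduct.inl : N →* SplitExt (γ b))) b,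
      ← PushoutI.of_apply_eq_base (fun b : Bool => (SemidirectProduct.inl : N →* SplitExt (γ b))) b,
      ← map_mul, ← map_mul]
    congr 1
    ext <;> simp
  | mul u v hu hv =>
    obtain ⟨y, hy⟩ := hv x
    obtain ⟨z, hz⟩ := hu y
    exact ⟨z, by rw [map_mul, mul_assoc, hy, ← mul_assoc, hz, mul_assoc]⟩

theorem exists_eq_base_mul_section (g : SplitAmalgam γ) :
    ∃ (x : N) (w : FreeComplement γ), g = PushoutI.base _ x * sectionHom γ w := by
  induction g using PushoutI.induction_on with
  | of b g =>
    refine ⟨g.left, CoprodI.of g.right, ?_⟩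
    rw [sectionHom, CoprodI.lift_of, MonoidHom.comp_apply,
      ← PushoutI.of_apply_eq_base (fun b : Bool => (SemidirectProduct.inl : N →* SplitExt (γ b))) b,
      ← map_mul, SemidirectProduct.inl_left_mul_inr_right]
  | base x => exact ⟨x, 1, by simp⟩
  | mul g h hg hh =>
    obtain ⟨x, u, rfl⟩ := hg
    obtain ⟨y, v, rfl⟩ := hh
    obtain ⟨z, hz⟩ := exists_section_mul_base γ u y
    refine ⟨x * z, u * v, ?_⟩
    rw [map_mul, map_mul, mul_assoc, ← mul_assoc (sectionHom γ u), hz]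
    simp only [mul_assoc]

variable {γ}

/-- Homomorphisms of `N` into `K` extend to the amalgam if the automorphisms become inner in `K`,
induced by elements of suitable order. -/
theorem exists_hom_extending {K : Type*} [Group K] (f : N →* K) {t : Bool → K}
    (ht : ∀ b, orderOf (t b) ∣ orderOf (γ b)) (hf : ∀ b x, t b * f x = f (γ b x) * t b) :
    ∃ F : SplitAmalgam γ →* K, ∀ x, F (PushoutI.base _ x) = f x := by
  have h : ∀ b, ∀ g : Subgroup.zpowers (γ b),
      f.comp (MulEquiv.toMonoidHom ((Subgroup.zpowers (γ b)).subtype g)) =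
        (MulEquiv.toMonoidHom (MulAut.conj (zpowersLift (ht b) g))).comp f := by
    intro b g
    -- Pairs whose second entry induces the first along `f` form a subgroup, so the relation for `(γ
    -- b, t b)` passes to all integer powers.
    let S : Subgroup (MulAut N × K) :=
      { carrier := {q | ∀ x, q.2 * f x = f (q.1 x) * q.2}
        one_mem' := by simp
        mul_mem' := fun {q r} hq hr x => by
          simp only [Prod.snd_mul, Prod.fst_mul, MulAut.mul_apply]
          rw [mul_assoc, hr x, ← mul_assoc, hq, mul_assoc]
        inv_mem' := fun {q} hq x => by
          have := hq (q.1⁻¹ x)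
          rw [MulAut.apply_inv_self] at this
          simp only [Prod.snd_inv, Prod.fst_inv]
          rw [inv_mul_eq_iff_eq_mul, ← mul_assoc, this, mul_inv_cancel_right] }
    have hS : (γ b, t b) ∈ S := hf b
    obtain ⟨g, k, rfl⟩ := g
    have hk : (⟨(fun m : ℤ => γ b ^ m) k, ⟨k, rfl⟩⟩ : Subgroup.zpowers (γ b)) =
      ⟨γ b, Subgroup.mem_zpowers _⟩ ^ k := rfl
    have hl : zpowersLift (ht b) (⟨γ b, Subgroup.mem_zpowers _⟩ ^ k) = t b ^ k := by
      rw [map_zpow, zpowersLift_gen]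
    ext x
    have h2 := S.zpow_mem hS k x
    rw [hk, hl]
    exact eq_mul_inv_of_mul_eq h2.symm
  exact ⟨PushoutI.lift (fun b => SemidirectProduct.lift f (zpowersLift (ht b)) (h b)) f
    fun b => SemidirectProduct.lift_comp_inl _ _ _, fun x => PushoutI.lift_base _ _ _ _⟩

end SplitAmalgam

end SplitAmalgam

/-! ### Residual `p`-finiteness -/

open SplitAmalgam in
theorem isResiduallyPFinite_P {p : ℕ} (hp : p.Prime) : IsResiduallyPFinite p (P p) := by
  have := Fact.mk hp
  intro g hg
  obtain ⟨x, w, rfl⟩ := exists_eq_base_mul_section (autFamily p) g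
  by_cases hw : w = 1
  · subst hw
    rw [map_one, mul_one] at hg ⊢
    have hx : x ≠ 1 := by
      rintro rfl
      exact hg (map_one _)
    obtain ⟨n, hn, hne⟩ := exists_levelHomH_ne_one hp hx
    choose π τ hπ hτ using exists_isLevelMap (n := n) p hn
    have hord : ∀ b, orderOf (τ b) ∣ orderOf (autFamily p b) := fun b => by
      -- A relation among automorphisms gives one in `Perm ℤ` by faithfulness, and then one for `τ
      -- b`.
      refine orderOf_dvd_of_pow_eq_one ((hτ b).pow_eq_one (permAutHom_injective hp ?_))
      rw [map_pow, map_one]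
      change permAut p (π b) ^ _ = 1
      rw [← hπ, pow_orderOf_eq_one]
    obtain ⟨F, hF⟩ := exists_hom_extending (levelHomH p n) hord fun b x => by
      rw [(hτ b).mul_levelHomH, hπ]
    have : NeZero (p ^ (n + 1)) := ⟨pow_ne_zero _ hp.ne_zero⟩
    refine exists_surjective_of_hom (f := F) (isPGroup_treeGroup (N := n + 1) ?_)
      (by rwa [hF])
    exact_mod_cast ZMod.natCast_self (p ^ (n + 1))
  · obtain ⟨n, f, hf⟩ := exists_hom_coprodI_zpowers (orderOf_autFamily hp) hw
    refine exists_surjective_of_hom (f := f.comp (proj (autFamily p)))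
      (isPGroup_unitriangular p) ?_
    rwa [MonoidHom.comp_apply, map_mul, proj_base, one_mul, proj_section]

end AmalgP

theorem proposition4p3 (p : ℕ) (hp : p.Prime) :
    AmalgP.IsResiduallyPFinite p (AmalgP.P p) ∧
      ¬ IsOfFinOrder (G := MulAut (AmalgP.H p))
        ((AmalgP.alpha p).symm.trans (AmalgP.beta p)) :=
  ⟨AmalgP.isResiduallyPFinite_P hp, AmalgP.not_isOfFinOrder_alpha_symm_trans_beta hp⟩
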